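/- Let $\mathcal H=-\partial_x^2+x^2$ be the one-dimensional harmonic oscillator, considered as an unbounded operator on $L^2(\mathbb R)=L^2(\mathbb R;\mathbb C)$ with domain $D(\mathcal H)=\{u\in L^2(\mathbb R):\ -u''+x^2u\in L^2(\mathbb R)\}$, where $-u''+x^2u$ is taken in the sense of distributions. Then $-\mathcal H$ is the infinitesimal generator of a strongly continuous semigroup $(e^{-t\mathcal H})_{t\ge 0}$ of bounded operators on $L^2(\mathbb R)$, and for every strongly continuous semigroup $(e^{-t\mathcal H})_{t\ge0}$ on $L^2(\mathbb R)$ with infinitesimal generator $-\mathcal H$ one has $$\forall t\ge 0,\qquad e^{-t\mathcal H}=e^{-\frac12(\tanh t)x^2}\,e^{\frac12\sinh(2t)\,\partial_x^2}\,e^{-\frac12(\tanh t)x^2}.$$ Here, for $a,s\ge0$, $e^{-ax^2}$ is the operator of multiplication by the function $x\mapsto e^{-ax^2}$ on $L^2(\mathbb R)$, and $e^{s\partial_x^2}$ is the Fourier multiplier on $L^2(\mathbb R)$ with symbol $e^{-s\xi^2}$, that is, $\widehat{e^{s\partial_x^2}u}(\xi)=e^{-s\xi^2}\,\widehat u(\xi)$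 with $\widehat u(\xi)=\int_{\mathbb R}e^{-ix\xi}u(x)\,dx$ (extended to $L^2(\mathbb R)$ by density). In particular, for every $t\ge0$, the operator $e^{-t\mathcal H}:L^2(\mathbb R)\to L^2(\mathbb R)$ is injective. -/

import Mathlib

open MeasureTheory Filter Topology
open scoped NNReal ENNReal SchwartzMap FourierTransform

noncomputable section

namespace HarmonicSplitting

/-- The Hilbert space `L²(ℝ) = L²(ℝ; ℂ)`. -/
abbrev L2 : Type := Lp ℂ 2 (volume : Measure ℝ)

/-! ### Strongly continuous semigroups and their generators -/

/-- A strongly continuous (one-parameter) semigroup of bounded operators on `L²(ℝ)`. -/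
structure C0Semigroup where
  /-- the evolution operator at time `t ≥ 0` -/
  op : ℝ≥0 → L2 →L[ℂ] L2
  op_zero : op 0 = ContinuousLinearMap.id ℂ L2
  op_add : ∀ s t : ℝ≥0, op (s + t) = (op s).comp (op t)
  continuous_orbit : ∀ u : L2, Continuous fun t : ℝ≥0 => op t u

/-- The graph of the infinitesimal generator: the pairs `(u, f)` such that
`(T_h u - u) / h → f` in `L²(ℝ)` as `h → 0⁺`. -/
def C0Semigroup.generatorGraph (S : C0Semigroup) : Submodule ℂ (L2 × L2) where
  carrier := {p | Tendsto (fun h : ℝ≥0 => ((h : ℝ) : ℂ)⁻¹ • (S.op h p.1 - p.1))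
    (𝓝[>] 0) (𝓝 p.2)}
  zero_mem' := by simp
  add_mem' := by
    intro p q hp hq
    refine (Tendsto.add hp hq).congr fun h => ?_
    simp only [Prod.fst_add, map_add, ← smul_add]
    congr 1
    abel
  smul_mem' := by
    intro c p hp
    refine (Tendsto.const_smul hp c).congr fun h => ?_
    simp only [Prod.smul_fst, map_smul, ← smul_sub]
    rw [smul_comm]

/-- The infinitesimal generator `A` of the semigroup, an unbounded operator on `L²(ℝ)`: its domain
consists of all `u` for which `A u = lim_{h → 0⁺} (T_h u - u) / h` exists. -/
def C0Semigroup.generator (S : C0Semigroup) : L2 →ₗ.[ℂ] L2 :=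
  S.generatorGraph.toLinearPMap

theorem C0Semigroup.generator_graph (S : C0Semigroup) :
    S.generator.graph = S.generatorGraph := by
  refine Submodule.toLinearPMap_graph_eq _ ?_
  rintro ⟨u, f⟩ hp hu
  obtain rfl : u = 0 := hu
  have hp' : Tendsto (fun h : ℝ≥0 => ((h : ℝ) : ℂ)⁻¹ • (S.op h (0 : L2) - 0))
    (𝓝[>] 0) (𝓝 f) := hp
  simp only [map_zero, sub_zero, smul_zero] at hp'
  exact (tendsto_nhds_unique hp' tendsto_const_nhds)

/-! ### The harmonic oscillator -/

/-- The differential operator `-∂_x² + x²` acting on tempered distributions on `ℝ`. -/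
def oscillatorDistrib : 𝓢'(ℝ, ℂ) →L[ℂ] 𝓢'(ℝ, ℂ) :=
  -((TemperedDistribution.derivCLM ℂ).comp (TemperedDistribution.derivCLM ℂ))
    + TemperedDistribution.smulLeftCLM ℂ (fun x : ℝ => (x : ℂ) ^ 2)

/-- On test functions, `⟨-T'' + x² T, φ⟩ = ⟨T, -φ'' + x² φ⟩`. -/
theorem oscillatorDistrib_apply (T : 𝓢'(ℝ, ℂ)) (φ ψ : 𝓢(ℝ, ℂ))
    (hψ : ∀ x : ℝ, ψ x = -deriv (deriv φ) x + (x : ℂ) ^ 2 * φ x) :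
    oscillatorDistrib T φ = T ψ := by
  have hg : Function.HasTemperateGrowth (fun x : ℝ => (x : ℂ) ^ 2) := by fun_prop
  have h : ψ = -(SchwartzMap.derivCLM ℂ ℂ (SchwartzMap.derivCLM ℂ ℂ φ))
      + SchwartzMap.smulLeftCLM ℂ (fun x : ℝ => (x : ℂ) ^ 2) φ := by
    ext x
    have hd : ⇑(SchwartzMap.derivCLM ℂ ℂ φ) = deriv φ := by
      ext y
      simp
    simp [hψ, SchwartzMap.smulLeftCLM_apply_apply hg, hd]
  rw [h, map_add, map_neg]
  simp [oscillatorDistrib]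

/-- The graph of the harmonic oscillator with its maximal domain in `L²(ℝ)`: the pairs `(u, f)` of
functions in `L²(ℝ)` with `-u'' + x² u = f` in the sense of distributions. -/
def oscillatorGraph : Submodule ℂ (L2 × L2) where
  carrier := {p | oscillatorDistrib (Lp.toTemperedDistributionCLM ℂ volume 2 p.1)
    = Lp.toTemperedDistributionCLM ℂ volume 2 p.2}
  zero_mem' := by
    change oscillatorDistrib (Lp.toTemperedDistributionCLM ℂ volume 2 (0 : L2))
      = Lp.toTemperedDistributionCLM ℂ volume 2 (0 : L2)
    rw [map_zero, map_zero]
  add_mem' := by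
    intro p q hp hq
    simp only [Set.mem_ofPred_eq, Prod.fst_add, Prod.snd_add, map_add] at hp hq ⊢
    rw [hp, hq]
  smul_mem' := by
    intro c p hp
    simp only [Set.mem_ofPred_eq, Prod.smul_fst, Prod.smul_snd, map_smul] at hp ⊢
    rw [hp]

/-- The harmonic oscillator `H = -∂_x² + x²` as an unbounded operator on `L²(ℝ)`, with domain
`{u ∈ L²(ℝ) : H u ∈ L²(ℝ)}`. -/
def harmonicOscillator : L2 →ₗ.[ℂ] L2 :=
  oscillatorGraph.toLinearPMap

theorem harmonicOscillator_graph : harmonicOscillator.graph = oscillatorGraph := by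
  refine Submodule.toLinearPMap_graph_eq _ ?_
  rintro ⟨u, f⟩ hp hu
  obtain rfl : u = 0 := hu
  have hp' : oscillatorDistrib (Lp.toTemperedDistributionCLM ℂ volume 2 (0 : L2))
    = Lp.toTemperedDistributionCLM ℂ volume 2 f := hp
  rw [map_zero, map_zero] at hp'
  have : f ∈ (Lp.toTemperedDistributionCLM ℂ (volume : Measure ℝ) 2).ker := hp'.symm
  rw [Lp.ker_toTemperedDistributionCLM_eq_bot] at this
  exact this

/-! ### The two elementary evolution operators -/

/-- The bounded function `x ↦ e^{-a x²}`, for `a ≥ 0`, as an element of `L^∞(ℝ)`. -/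
def gaussianLp (a : ℝ) (ha : 0 ≤ a) : Lp ℂ ∞ (volume : Measure ℝ) :=
  MemLp.toLp (fun x : ℝ => ((Real.exp (-(a * x ^ 2)) : ℝ) : ℂ))
    (memLp_top_of_bound (by fun_prop) 1 (Eventually.of_forall fun x => by
      rw [Complex.norm_real, Real.norm_of_nonneg (Real.exp_pos _).le, Real.exp_le_one_iff]
      have := mul_nonneg ha (sq_nonneg x)
      linarith))

/-- The operator `e^{-a x²}` on `L²(ℝ)`, for `a ≥ 0`: multiplication by the function
`x ↦ e^{-a x²}`. -/
def expNegSq (a : ℝ) (ha : 0 ≤ a) : L2 →L[ℂ] L2 :=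
  (ContinuousLinearMap.mul ℂ ℂ).holderL volume ∞ 2 2 (gaussianLp a ha)

theorem expNegSq_coeFn (a : ℝ) (ha : 0 ≤ a) (u : L2) :
    (expNegSq a ha u : ℝ → ℂ) =ᵐ[volume] fun x => ((Real.exp (-(a * x ^ 2)) : ℝ) : ℂ) * u x := by
  have h1 := (ContinuousLinearMap.mul ℂ ℂ).coeFn_holder (r := 2) (gaussianLp a ha) u
  have h2 : (gaussianLp a ha : ℝ → ℂ) =ᵐ[volume] _ := MemLp.coeFn_toLp _
  filter_upwards [h1, h2] with x hx1 hx2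
  rw [hx2] at hx1
  exact hx1

/-- The heat operator `e^{s ∂_x²}` on `L²(ℝ)`, for `s ≥ 0`: the Fourier multiplier with symbol
`e^{-s ξ²}`, where `ξ` is the variable dual to `x` for the phase `e^{-i x ξ}`. Mathlib's Fourier
transform uses the phase `e^{-2 π i x η}`, so that `ξ = 2 π η` and the symbol is
`e^{-s (2 π η)²} = e^{-((2 π)² s) η²}`. -/
def heat (s : ℝ) (hs : 0 ≤ s) : L2 →L[ℂ] L2 :=
  ((Lp.fourierTransformₗᵢ ℝ ℂ).symm : L2 →L[ℂ] L2).comp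
    ((expNegSq ((2 * Real.pi) ^ 2 * s) (by positivity)).comp
      ((Lp.fourierTransformₗᵢ ℝ ℂ) : L2 →L[ℂ] L2))

theorem half_tanh_nonneg (t : ℝ≥0) : 0 ≤ Real.tanh t / 2 := by
  rw [Real.tanh_eq_sinh_div_cosh]
  have h1 : 0 ≤ Real.sinh t := Real.sinh_nonneg_iff.2 t.2
  have h2 := Real.cosh_pos (t : ℝ)
  positivity

theorem half_sinh_two_mul_nonneg (t : ℝ≥0) : 0 ≤ Real.sinh (2 * t) / 2 := by
  have h1 : 0 ≤ Real.sinh (2 * (t : ℝ)) := Real.sinh_nonneg_iff.2 (by positivity)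
  positivity

end HarmonicSplitting

end

noncomputable section

namespace HarmonicSplitting

open Polynomial in
theorem iteratedDeriv_cexp_quadratic (p b c : ℂ) (n : ℕ) :
    ∃ P : ℂ[X], iteratedDeriv n (fun x : ℝ => Complex.exp (-p * x ^ 2 + b * x + c)) =
      fun x : ℝ => P.eval (x : ℂ) * Complex.exp (-p * x ^ 2 + b * x + c) := by
  induction n with
  | zero => exact ⟨1, by simp⟩
  | succ n ih =>
    obtain ⟨P, hP⟩ := ih
    refine ⟨derivative P + P * (C (-2 * p) * X + C b), ?_⟩
    rw [iteratedDeriv_succ, hP]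
    ext x
    have h1 : HasDerivAt (fun z : ℂ => P.eval z * Complex.exp (-p * z ^ 2 + b * z + c))
        ((derivative P).eval (x : ℂ) * Complex.exp (-p * x ^ 2 + b * x + c) +
          P.eval (x : ℂ) * (Complex.exp (-p * x ^ 2 + b * x + c) *
            (-p * (2 * x) + b))) (x : ℂ) := by
      refine (P.hasDerivAt _).mul (HasDerivAt.cexp ?_)
      have := (((hasDerivAt_pow 2 (x : ℂ)).const_mul (-p)).add
        ((hasDerivAt_id (x : ℂ)).const_mul b)).add_const c
      simpa using this
    rw [h1.comp_ofReal.deriv]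
    simp only [eval_add, eval_mul, eval_C, eval_X]
    ring

open Polynomial in
theorem exists_bound_polynomial_mul_cexp_quadratic {p : ℝ} (hp : 0 < p) (b c : ℂ) (P : ℂ[X]) :
    ∃ C : ℝ, ∀ x : ℝ, ‖P.eval (x : ℂ) * Complex.exp (-p * x ^ 2 + b * x + c)‖ ≤ C := by
  induction P using Polynomial.induction_on' with
  | add P Q hP hQ =>
    obtain ⟨A, hA⟩ := hP
    obtain ⟨B, hB⟩ := hQ
    refine ⟨A + B, fun x => ?_⟩
    rw [eval_add, add_mul]
    exact (norm_add_le _ _).trans (add_le_add (hA x) (hB x))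
  | monomial n a =>
    refine ⟨‖a‖ * (n.factorial * Real.exp ((|b.re| + 1) ^ 2 / (4 * p) + c.re)), fun x => ?_⟩
    rw [eval_monomial, norm_mul, norm_mul, mul_assoc, norm_pow, Complex.norm_real,
      Real.norm_eq_abs, Complex.norm_exp]
    refine mul_le_mul_of_nonneg_left ?_ (norm_nonneg a)
    have h1 : (-(p : ℂ) * (x : ℂ) ^ 2 + b * x + c).re = -p * x ^ 2 + b.re * x + c.re := by
      have : ((x : ℂ) ^ 2) = ((x ^ 2 : ℝ) : ℂ) := by push_cast; rfl
      rw [this, Complex.add_re, Complex.add_re, ← Complex.ofReal_neg, ← Complex.ofReal_mul,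
        Complex.ofReal_re, Complex.re_mul_ofReal]
    have h2 : |x| ^ n ≤ n.factorial * Real.exp |x| := by
      have := Real.pow_div_factorial_le_exp |x| (abs_nonneg x) n
      rwa [div_le_iff₀' (by positivity)] at this
    have h3 : -p * x ^ 2 + b.re * x ≤ (|b.re| + 1) ^ 2 / (4 * p) - |x| := by
      have h4 : b.re * x ≤ |b.re| * |x| := (le_abs_self _).trans (abs_mul _ _).le
      have h5 : (|b.re| + 1) ^ 2 / (4 * p) - (|b.re| + 1) * |x| + p * |x| ^ 2
          = (|b.re| + 1 - 2 * p * |x|) ^ 2 / (4 * p) := by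
        field_simp
        ring
      have h6 : 0 ≤ (|b.re| + 1 - 2 * p * |x|) ^ 2 / (4 * p) := by positivity
      rw [sq_abs] at h5
      linarith
    calc |x| ^ n * Real.exp (-(p : ℂ) * (x : ℂ) ^ 2 + b * x + c).re
        ≤ (n.factorial * Real.exp |x|)
          * Real.exp ((|b.re| + 1) ^ 2 / (4 * p) - |x| + c.re) := by
          rw [h1]
          gcongr
      _ = _ := by
          rw [mul_assoc, ← Real.exp_add]
          ring_nf

/-- The Gaussian `x ↦ exp (-p x² + b x + c)`, for `p > 0`, as a Schwartz function. -/
def gaussianSchwartz (p : ℝ) (hp : 0 < p) (b c : ℂ) : 𝓢(ℝ, ℂ) where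
  toFun x := Complex.exp (-p * x ^ 2 + b * x + c)
  smooth' := by
    have : ContDiff ℝ (⊤ : ℕ∞) (fun x : ℝ => (x : ℂ)) := Complex.ofRealCLM.contDiff
    exact ((contDiff_const.mul (this.pow 2)).add (contDiff_const.mul this)).add
      contDiff_const |>.cexp
  decay' k n := by
    obtain ⟨P, hP⟩ := iteratedDeriv_cexp_quadratic p b c n
    obtain ⟨C, hC⟩ := exists_bound_polynomial_mul_cexp_quadratic hp b c (Polynomial.X ^ k * P)
    refine ⟨C, fun x => ?_⟩
    rw [norm_iteratedFDeriv_eq_norm_iteratedDeriv, hP]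
    refine le_trans (le_of_eq ?_) (hC x)
    simp [mul_assoc]

theorem gaussianSchwartz_apply (p : ℝ) (hp : 0 < p) (b c : ℂ) (x : ℝ) :
    gaussianSchwartz p hp b c x = Complex.exp (-p * x ^ 2 + b * x + c) := rfl

theorem fourier_gaussianSchwartz_apply (p : ℝ) (hp : 0 < p) (b c : ℂ) (ξ : ℝ) :
    𝓕 (gaussianSchwartz p hp b c) ξ = (Real.pi / p : ℂ) ^ (1 / 2 : ℂ) *
      Complex.exp (c + (b - 2 * Real.pi * Complex.I * ξ) ^ 2 / (4 * p)) := by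
  rw [SchwartzMap.fourier_coe, Real.fourier_real_eq_integral_exp_smul]
  have h := integral_cexp_quadratic (b := -(p : ℂ)) (by simpa using hp)
    (b - 2 * Real.pi * Complex.I * ξ) c
  rw [neg_neg] at h
  refine Eq.trans (integral_congr_ae (Eventually.of_forall fun x => ?_)) (h.trans ?_)
  · simp only [gaussianSchwartz_apply, smul_eq_mul]
    rw [← Complex.exp_add]
    congr 1
    push_cast
    ring
  · congr 2
    rw [mul_neg, div_neg]
    ring

theorem inner_toLp_left (φ : 𝓢(ℝ, ℂ)) (u : L2) :
    inner ℂ (φ.toLp 2) u = ∫ x, starRingEnd ℂ (φ x) * u x := by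
  rw [MeasureTheory.L2.inner_def]
  refine integral_congr_ae ?_
  filter_upwards [φ.coeFn_toLp 2] with x hx
  rw [hx, RCLike.inner_apply, mul_comm]

theorem integral_schwartz_mul_eq_zero_of_fourier_eq_zero {h : ℝ → ℂ} (hint : Integrable h)
    (hF : 𝓕 h = 0) (φ : 𝓢(ℝ, ℂ)) : ∫ x, φ x * h x = 0 := by
  have h1 : ∫ x, 𝓕 (𝓕⁻ φ : 𝓢(ℝ, ℂ)) x * h x = ∫ x, (𝓕⁻ φ : 𝓢(ℝ, ℂ)) x * 𝓕 h x := by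
    have h2 := VectorFourier.integral_fourierIntegral_smul_eq_flip (L := innerₗ ℝ)
      (μ := volume) (ν := volume)
      Real.continuous_fourierChar continuous_inner (𝓕⁻ φ : 𝓢(ℝ, ℂ)).integrable hint
    rw [flip_innerₗ] at h2
    exact h2
  rw [FourierTransform.fourier_fourierInv_eq, hF] at h1
  simpa using h1

/-- The Fourier transform is injective on `L¹(ℝ)`. -/
theorem ae_eq_zero_of_fourier_eq_zero {h : ℝ → ℂ} (hint : Integrable h) (hF : 𝓕 h = 0) :
    ∀ᵐ x, h x = 0 := by
  refine ae_eq_zero_of_integral_contDiff_smul_eq_zero hint.locallyIntegrable ?_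
  intro f hf hfc
  have hfc' : HasCompactSupport (Complex.ofRealCLM ∘ f) := hfc.comp_left rfl
  have hf' : ContDiff ℝ (⊤ : ℕ∞) (Complex.ofRealCLM ∘ f) := Complex.ofRealCLM.contDiff.comp hf
  have := integral_schwartz_mul_eq_zero_of_fourier_eq_zero hint hF (hfc'.toSchwartzMap hf')
  simpa using this

/-- The Gaussians `x ↦ exp (-x² / 2 + i β x)`, `β ∈ ℝ`, are total in `L²(ℝ)`. -/
theorem eq_zero_of_inner_gaussian_eq_zero (w : L2)
    (hw : ∀ β : ℝ, inner ℂ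
      ((gaussianSchwartz (1 / 2) (by norm_num) (Complex.I * β) 0).toLp 2) w = 0) : w = 0 := by
  set g := gaussianSchwartz (1 / 2) (by norm_num) 0 0 with hg
  have hint : Integrable (fun x => g x * w x) :=
    MemLp.integrable_mul (p := 2) (q := 2) (g.memLp 2) (Lp.memLp w)
  have hF : 𝓕 (fun x => g x * w x) = 0 := by
    ext ξ
    rw [Real.fourier_real_eq_integral_exp_smul, Pi.zero_apply, ← hw (2 * Real.pi * ξ),
      inner_toLp_left]
    refine integral_congr_ae (Eventually.of_forall fun x => ?_)
    simp only [hg, gaussianSchwartz_apply, smul_eq_mul, ← mul_assoc]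
    rw [← Complex.exp_add, ← Complex.exp_conj]
    congr 2
    simp only [map_add, map_mul, map_neg, map_pow, map_zero, Complex.conj_ofReal, Complex.conj_I]
    push_cast
    ring
  rw [Lp.eq_zero_iff_ae_eq_zero]
  filter_upwards [ae_eq_zero_of_fourier_eq_zero hint hF] with x hx
  have hx' : g x ≠ 0 := by
    rw [hg, gaussianSchwartz_apply]
    exact Complex.exp_ne_zero _
  exact (mul_eq_zero.1 hx).resolve_left hx'

theorem norm_sq_eq_integral (u : L2) : ‖u‖ ^ 2 = ∫ x, ‖u x‖ ^ 2 := by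
  have h := inner_self_eq_norm_sq_to_K (𝕜 := ℂ) u
  rw [MeasureTheory.L2.inner_def] at h
  have h2 : ∀ x, inner ℂ (u x) (u x) = ((‖u x‖ ^ 2 : ℝ) : ℂ) := fun x => by
    rw [inner_self_eq_norm_sq_to_K]
    norm_cast
  simp_rw [h2] at h
  rw [integral_complex_ofReal] at h
  exact (Complex.ofReal_injective (by rw [h]; norm_cast)).symm

/-- Dominated convergence in `L²(ℝ)`. -/
theorem tendsto_L2_of_dominated {ι : Type*} {l : Filter ι} [l.IsCountablyGenerated]
    {F : ι → L2} {f : L2} (bound : L2) (m : ι → ℝ → ℂ)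
    (hF : ∀ᶠ i in l, F i =ᵐ[volume] m i)
    (hb : ∀ᶠ i in l, ∀ᵐ x, ‖m i x‖ ≤ ‖bound x‖)
    (hl : ∀ᵐ x, Tendsto (fun i => m i x) l (𝓝 (f x))) : Tendsto F l (𝓝 f) := by
  rw [tendsto_iff_norm_sub_tendsto_zero]
  have key : Tendsto (fun i => ∫ x, ‖(F i - f) x‖ ^ 2) l (𝓝 (∫ _ : ℝ, (0 : ℝ))) := by
    have hsub : ∀ᶠ i in l, ∀ᵐ x, ‖(F i - f) x‖ ^ 2 = ‖m i x - f x‖ ^ 2 := by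
      filter_upwards [hF] with i hi
      filter_upwards [hi, Lp.coeFn_sub (F i) f] with x hx hx'
      rw [hx', Pi.sub_apply, hx]
    have key' : Tendsto (fun i => ∫ x, ‖m i x - f x‖ ^ 2) l (𝓝 (∫ _ : ℝ, (0 : ℝ))) := by
      refine tendsto_integral_filter_of_dominated_convergence
        (fun x => (‖bound x‖ + ‖f x‖) ^ 2) ?_ ?_ ?_ ?_
      · filter_upwards [hF] with i hi
        exact ((((Lp.aestronglyMeasurable (F i)).congr hi).sub
          (Lp.aestronglyMeasurable f)).norm.pow 2)
      · filter_upwards [hb] with i hi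
        filter_upwards [hi] with x hx
        rw [norm_pow, norm_norm]
        gcongr
        exact (norm_sub_le _ _).trans (add_le_add_left hx _)
      · exact ((Lp.memLp bound).norm.add (Lp.memLp f).norm).integrable_sq
      · filter_upwards [hl] with x hx
        have := ((hx.sub_const (f x)).norm).pow 2
        simpa using this
    refine key'.congr' ?_
    filter_upwards [hsub] with i hi
    exact (integral_congr_ae hi).symm
  simp_rw [← norm_sq_eq_integral] at key
  have := key.sqrt
  simpa using this

theorem tendsto_inv_mul_sub_of_hasDerivAt {f : ℝ → ℝ} {κ : ℝ} (hf : HasDerivAt f κ 0) :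
    Tendsto (fun a : ℝ≥0 => (((a : ℝ)⁻¹ * (f a - f 0) : ℝ) : ℂ)) (𝓝[>] 0) (𝓝 (κ : ℂ)) := by
  have h2 : Tendsto (fun a : ℝ≥0 => (a : ℝ)) (𝓝[>] 0) (𝓝[≠] 0) := by
    refine tendsto_nhdsWithin_iff.2 ⟨?_, ?_⟩
    · exact (NNReal.continuous_coe.tendsto' 0 0 rfl).mono_left nhdsWithin_le_nhds
    · filter_upwards [self_mem_nhdsWithin] with a ha
      exact (NNReal.coe_pos.2 ha).ne'
  have h3 := (hasDerivAt_iff_tendsto_slope.1 hf).comp h2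
  refine ((Complex.continuous_ofReal.tendsto _).comp h3).congr fun a => ?_
  simp [slope_def_field, div_eq_inv_mul]

/-! ### The multiplication operator -/

theorem norm_gaussian_le_one {a : ℝ} (ha : 0 ≤ a) (x : ℝ) :
    ‖((Real.exp (-(a * x ^ 2)) : ℝ) : ℂ)‖ ≤ 1 := by
  rw [Complex.norm_real, Real.norm_of_nonneg (Real.exp_pos _).le, Real.exp_le_one_iff]
  have := mul_nonneg ha (sq_nonneg x)
  linarith

theorem expNegSq_congr {a b : ℝ} (h : a = b) (ha : 0 ≤ a) (hb : 0 ≤ b) :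
    expNegSq a ha = expNegSq b hb := by
  subst h
  rfl

theorem norm_expNegSq_apply_le (a : ℝ) (ha : 0 ≤ a) (u : L2) : ‖expNegSq a ha u‖ ≤ ‖u‖ := by
  refine Lp.norm_le_norm_of_ae_le ?_
  filter_upwards [expNegSq_coeFn a ha u] with x hx
  rw [hx, norm_mul]
  exact mul_le_of_le_one_left (norm_nonneg _) (norm_gaussian_le_one ha x)

theorem inner_expNegSq_left (a : ℝ) (ha : 0 ≤ a) (u v : L2) :
    inner ℂ (expNegSq a ha u) v = inner ℂ u (expNegSq a ha v) := by
  rw [MeasureTheory.L2.inner_def, MeasureTheory.L2.inner_def]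
  refine integral_congr_ae ?_
  filter_upwards [expNegSq_coeFn a ha u, expNegSq_coeFn a ha v] with x hx hx'
  rw [hx, hx', RCLike.inner_apply, RCLike.inner_apply, map_mul, Complex.conj_ofReal]
  ring

theorem expNegSq_zero : expNegSq 0 le_rfl = ContinuousLinearMap.id ℂ L2 := by
  ext1 u
  refine Lp.ext ?_
  filter_upwards [expNegSq_coeFn 0 le_rfl u] with x hx
  simp [hx]

theorem expNegSq_injective (a : ℝ) (ha : 0 ≤ a) : Function.Injective (expNegSq a ha) := by
  refine (injective_iff_map_eq_zero _).2 fun u hu => ?_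
  rw [Lp.eq_zero_iff_ae_eq_zero] at hu ⊢
  filter_upwards [hu, expNegSq_coeFn a ha u] with x hx hx'
  rw [hx'] at hx
  refine (mul_eq_zero.1 hx).resolve_left ?_
  exact_mod_cast (Real.exp_pos _).ne'

theorem continuous_expNegSq_apply (u : L2) :
    Continuous fun a : ℝ≥0 => expNegSq (a : ℝ) a.coe_nonneg u := by
  rw [continuous_iff_continuousAt]
  intro a₀
  refine tendsto_L2_of_dominated u
    (fun (a : ℝ≥0) x => ((Real.exp (-(a * x ^ 2)) : ℝ) : ℂ) * u x) ?_ ?_ ?_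
  · exact Eventually.of_forall fun a => expNegSq_coeFn _ _ u
  · refine Eventually.of_forall fun a => Eventually.of_forall fun x => ?_
    rw [norm_mul]
    exact mul_le_of_le_one_left (norm_nonneg _) (norm_gaussian_le_one a.coe_nonneg x)
  · filter_upwards [expNegSq_coeFn a₀ a₀.coe_nonneg u] with x hx
    rw [hx]
    have : Continuous fun a : ℝ≥0 => ((Real.exp (-(a * x ^ 2)) : ℝ) : ℂ) * u x := by fun_prop
    exact this.tendsto a₀

theorem tendsto_expNegSq_sub_div (u g : L2) (hg : g =ᵐ[volume] fun x => (x : ℂ) ^ 2 * u x) :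
    Tendsto (fun a : ℝ≥0 => ((a : ℝ) : ℂ)⁻¹ • (expNegSq (a : ℝ) a.coe_nonneg u - u))
      (𝓝[>] 0) (𝓝 (-g)) := by
  refine tendsto_L2_of_dominated g
    (fun (a : ℝ≥0) x => (((a : ℝ)⁻¹ * (Real.exp (-(a * x ^ 2)) - 1) : ℝ) : ℂ) * u x) ?_ ?_ ?_
  · refine Eventually.of_forall fun a => ?_
    filter_upwards [expNegSq_coeFn a a.coe_nonneg u, Lp.coeFn_smul ((a : ℝ) : ℂ)⁻¹ (expNegSq (a : ℝ) a.coe_nonneg u - u),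
      Lp.coeFn_sub (expNegSq (a : ℝ) a.coe_nonneg u) u] with x h1 h2 h3
    rw [h2, Pi.smul_apply, h3, Pi.sub_apply, h1, smul_eq_mul]
    push_cast
    ring
  · filter_upwards [self_mem_nhdsWithin] with a ha
    have ha' : 0 < (a : ℝ) := ha
    filter_upwards [hg] with x hx
    rw [hx, norm_mul, norm_mul]
    refine mul_le_mul_of_nonneg_right ?_ (norm_nonneg _)
    rw [Complex.norm_real, Real.norm_eq_abs, abs_mul, abs_of_pos (inv_pos.2 ha'), norm_pow,
      Complex.norm_real, Real.norm_eq_abs, sq_abs, inv_mul_le_iff₀ ha', abs_le]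
    have h1 := Real.add_one_le_exp (-(a * x ^ 2 : ℝ))
    have h2 : Real.exp (-(a * x ^ 2 : ℝ)) ≤ 1 := Real.exp_le_one_iff.2 (by
      have : 0 ≤ (a : ℝ) * x ^ 2 := by positivity
      linarith)
    have h3 : 0 ≤ (a : ℝ) * x ^ 2 := by positivity
    constructor <;> linarith
  · filter_upwards [hg, Lp.coeFn_neg g] with x hx hx'
    rw [hx', Pi.neg_apply, hx, ← neg_mul]
    refine Tendsto.mul_const _ ?_
    have h1 : HasDerivAt (fun a : ℝ => Real.exp (-(a * x ^ 2))) (-x ^ 2) 0 := by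
      have := ((hasDerivAt_id (0 : ℝ)).mul_const (x ^ 2)).neg.exp
      simpa using this
    have h2 := tendsto_inv_mul_sub_of_hasDerivAt h1
    simpa using h2

/-! ### The heat operator -/

theorem fourier_heat (s : ℝ) (hs : 0 ≤ s) (u : L2) :
    Lp.fourierTransformₗᵢ ℝ ℂ (heat s hs u) =
      expNegSq ((2 * Real.pi) ^ 2 * s) (by positivity) (Lp.fourierTransformₗᵢ ℝ ℂ u) :=
  LinearIsometryEquiv.apply_symm_apply _ _

theorem norm_heat_apply_le (s : ℝ) (hs : 0 ≤ s) (u : L2) : ‖heat s hs u‖ ≤ ‖u‖ := by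
  rw [← (Lp.fourierTransformₗᵢ ℝ ℂ).norm_map, fourier_heat]
  exact (norm_expNegSq_apply_le _ _ _).trans_eq ((Lp.fourierTransformₗᵢ ℝ ℂ).norm_map u)

theorem inner_heat_left (s : ℝ) (hs : 0 ≤ s) (u v : L2) :
    inner ℂ (heat s hs u) v = inner ℂ u (heat s hs v) := by
  rw [← (Lp.fourierTransformₗᵢ ℝ ℂ).inner_map_map, fourier_heat, inner_expNegSq_left,
    ← fourier_heat, (Lp.fourierTransformₗᵢ ℝ ℂ).inner_map_map]

theorem heat_zero : heat 0 le_rfl = ContinuousLinearMap.id ℂ L2 := by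
  ext1 u
  apply (Lp.fourierTransformₗᵢ ℝ ℂ).injective
  rw [fourier_heat, expNegSq_congr (mul_zero _) _ le_rfl, expNegSq_zero]
  rfl

theorem heat_injective (s : ℝ) (hs : 0 ≤ s) : Function.Injective (heat s hs) := by
  intro u v huv
  have := congrArg (Lp.fourierTransformₗᵢ ℝ ℂ) huv
  rw [fourier_heat, fourier_heat] at this
  exact (Lp.fourierTransformₗᵢ ℝ ℂ).injective (expNegSq_injective _ _ this)

theorem continuous_heat_apply (u : L2) :
    Continuous fun s : ℝ≥0 => heat (s : ℝ) s.coe_nonneg u := by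
  have h : Continuous fun s : ℝ≥0 => (2 * NNReal.pi) ^ 2 * s := by fun_prop
  have h1 := (continuous_expNegSq_apply (Lp.fourierTransformₗᵢ ℝ ℂ u)).comp h
  refine ((Lp.fourierTransformₗᵢ ℝ ℂ).symm.continuous.comp h1).congr fun s => ?_
  rw [Function.comp_apply, LinearIsometryEquiv.symm_apply_eq, fourier_heat]
  exact congrArg (fun T : L2 →L[ℂ] L2 => T _) (expNegSq_congr (by simp) _ _)

theorem fourier_derivCLM_apply (φ : 𝓢(ℝ, ℂ)) (ξ : ℝ) :
    𝓕 (SchwartzMap.derivCLM ℂ ℂ φ) ξ = 2 * Real.pi * Complex.I * ξ * 𝓕 φ ξ := by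
  have hd : ⇑(SchwartzMap.derivCLM ℂ ℂ φ) = deriv φ := by
    ext y
    simp
  rw [SchwartzMap.fourier_coe, SchwartzMap.fourier_coe, hd,
    Real.fourier_deriv φ.integrable φ.differentiable
      (hd ▸ (SchwartzMap.derivCLM ℂ ℂ φ).integrable)]
  simp

theorem fourierTransformₗᵢ_toLp (φ : 𝓢(ℝ, ℂ)) :
    Lp.fourierTransformₗᵢ ℝ ℂ (φ.toLp 2) = (𝓕 φ).toLp 2 :=
  SchwartzMap.toLp_fourier_eq φ

theorem tendsto_heat_sub_div (φ : 𝓢(ℝ, ℂ)) :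
    Tendsto (fun s : ℝ≥0 => ((s : ℝ) : ℂ)⁻¹ •
        (heat (s : ℝ) s.coe_nonneg (φ.toLp 2) - φ.toLp 2 volume))
      (𝓝[>] 0) (𝓝 ((SchwartzMap.derivCLM ℂ ℂ (SchwartzMap.derivCLM ℂ ℂ φ)).toLp 2 volume)) := by
  obtain ⟨c, hc⟩ : ∃ c : ℝ≥0, (c : ℝ) = (2 * Real.pi) ^ 2 := ⟨(2 * NNReal.pi) ^ 2, by simp⟩
  have hc0 : 0 < c := by
    rw [← NNReal.coe_pos, hc]
    positivity
  have hcc : ((c : ℝ) : ℂ) ≠ 0 := by exact_mod_cast hc0.ne'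
  set F := Lp.fourierTransformₗᵢ ℝ ℂ with hF
  set ψ := SchwartzMap.derivCLM ℂ ℂ (SchwartzMap.derivCLM ℂ ℂ φ) with hψ
  have h1 := tendsto_expNegSq_sub_div (F (φ.toLp 2))
    (-(((c : ℝ) : ℂ)⁻¹ • F (ψ.toLp 2))) (by
      rw [hF, fourierTransformₗᵢ_toLp, fourierTransformₗᵢ_toLp]
      filter_upwards [(𝓕 φ).coeFn_toLp 2 volume, (𝓕 ψ).coeFn_toLp 2 volume,
        Lp.coeFn_neg (((c : ℝ) : ℂ)⁻¹ • (𝓕 ψ).toLp 2 volume),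
        Lp.coeFn_smul (((c : ℝ) : ℂ)⁻¹) ((𝓕 ψ).toLp 2 volume)] with x h1 h2 h3 h4
      rw [h3, Pi.neg_apply, h4, Pi.smul_apply, h1, h2, hψ, fourier_derivCLM_apply,
        fourier_derivCLM_apply, smul_eq_mul, inv_mul_eq_div, neg_eq_iff_eq_neg,
        div_eq_iff hcc, hc]
      push_cast
      linear_combination (4 * (Real.pi : ℂ) ^ 2 * x ^ 2 * 𝓕 φ x) * Complex.I_sq)
  have h2 : Tendsto (fun s : ℝ≥0 => c * s) (𝓝[>] 0) (𝓝[>] 0) := by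
    refine tendsto_nhdsWithin_iff.2 ⟨?_, ?_⟩
    · exact ((continuous_const_mul c).tendsto' 0 0 (mul_zero _)).mono_left nhdsWithin_le_nhds
    · filter_upwards [self_mem_nhdsWithin] with a ha
      exact mul_pos hc0 ha
  have h3 := ((F.symm.continuous.tendsto _).comp (h1.comp h2)).const_smul ((c : ℝ) : ℂ)
  rw [neg_neg, map_smul, smul_smul, mul_inv_cancel₀ hcc, one_smul, F.symm_apply_apply] at h3
  refine h3.congr fun s => ?_
  apply F.injective
  simp only [Function.comp_apply, map_smul, map_sub, F.apply_symm_apply, NNReal.coe_mul,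
    Complex.ofReal_mul, mul_inv, smul_smul]
  rw [← mul_assoc, mul_inv_cancel₀ hcc, one_mul, hF, fourier_heat,
    expNegSq_congr (a := (2 * Real.pi) ^ 2 * s) (b := ↑(c * s)) (by rw [NNReal.coe_mul, hc]) _
      (c * s).coe_nonneg]
  rfl

/-! ### The factorized evolution operator -/

/-- The operator `e^{-(tanh t / 2) x²} e^{(sinh (2 t) / 2) ∂_x²} e^{-(tanh t / 2) x²}`. -/
def mehler (t : ℝ≥0) : L2 →L[ℂ] L2 :=
  (expNegSq (Real.tanh t / 2) (half_tanh_nonneg t)).comp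
    ((heat (Real.sinh (2 * t) / 2) (half_sinh_two_mul_nonneg t)).comp
      (expNegSq (Real.tanh t / 2) (half_tanh_nonneg t)))

theorem mehler_apply (t : ℝ≥0) (u : L2) :
    mehler t u = expNegSq (Real.tanh t / 2) (half_tanh_nonneg t)
      (heat (Real.sinh (2 * t) / 2) (half_sinh_two_mul_nonneg t)
        (expNegSq (Real.tanh t / 2) (half_tanh_nonneg t) u)) := rfl

theorem mehler_injective (t : ℝ≥0) : Function.Injective (mehler t) :=
  fun _ _ h => expNegSq_injective _ (half_tanh_nonneg t)
    (heat_injective _ (half_sinh_two_mul_nonneg t) (expNegSq_injective _ (half_tanh_nonneg t) h))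

theorem norm_mehler_apply_le (t : ℝ≥0) (u : L2) : ‖mehler t u‖ ≤ ‖u‖ :=
  (norm_expNegSq_apply_le _ (half_tanh_nonneg t) _).trans
    ((norm_heat_apply_le _ (half_sinh_two_mul_nonneg t) _).trans
      (norm_expNegSq_apply_le _ (half_tanh_nonneg t) _))

theorem inner_mehler_left (t : ℝ≥0) (u v : L2) :
    inner ℂ (mehler t u) v = inner ℂ u (mehler t v) := by
  rw [mehler_apply, inner_expNegSq_left, inner_heat_left, inner_expNegSq_left, mehler_apply]

theorem heat_congr {a b : ℝ} (h : a = b) (ha : 0 ≤ a) (hb : 0 ≤ b) :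
    heat a ha = heat b hb := by
  subst h
  rfl

theorem mehler_zero : mehler 0 = ContinuousLinearMap.id ℂ L2 := by
  ext1 u
  rw [mehler_apply, expNegSq_congr (by simp) (half_tanh_nonneg 0) le_rfl,
    heat_congr (by simp) (half_sinh_two_mul_nonneg 0) le_rfl, expNegSq_zero, heat_zero]
  rfl

/-! ### Action on Gaussians -/

theorem gaussianSchwartz_congr {p p' : ℝ} (hp : 0 < p) (hp' : 0 < p') {b b' c c' : ℂ}
    (h1 : p = p') (h2 : b = b') (h3 : c = c') :
    gaussianSchwartz p hp b c = gaussianSchwartz p' hp' b' c' := by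
  subst h1 h2 h3
  rfl

theorem expNegSq_gaussianSchwartz (a : ℝ) (ha : 0 ≤ a) (p : ℝ) (hp : 0 < p) (b c : ℂ) :
    expNegSq a ha ((gaussianSchwartz p hp b c).toLp 2) =
      (gaussianSchwartz (p + a) (by positivity) b c).toLp 2 := by
  refine Lp.ext ?_
  filter_upwards [expNegSq_coeFn a ha ((gaussianSchwartz p hp b c).toLp 2),
    (gaussianSchwartz p hp b c).coeFn_toLp 2 volume,
    (gaussianSchwartz (p + a) (by positivity) b c).coeFn_toLp 2 volume] with x h1 h2 h3
  rw [h1, h2, h3, gaussianSchwartz_apply, gaussianSchwartz_apply, Complex.ofReal_exp,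
    ← Complex.exp_add]
  congr 1
  push_cast
  ring

theorem exp_mul_fourier_gaussianSchwartz (s : ℝ) (hs : 0 ≤ s) (p : ℝ) (hp : 0 < p) (b c : ℂ)
    (ξ : ℝ) :
    ((Real.exp (-((2 * Real.pi) ^ 2 * s * ξ ^ 2)) : ℝ) : ℂ) * 𝓕 (gaussianSchwartz p hp b c) ξ =
      𝓕 (gaussianSchwartz (p / (1 + 4 * s * p)) (by positivity) (b / (1 + 4 * s * p))
        (c + b ^ 2 * s / (1 + 4 * s * p) - Real.log (1 + 4 * s * p) / 2)) ξ := by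
  rw [fourier_gaussianSchwartz_apply, fourier_gaussianSchwartz_apply]
  have hD : 0 < 1 + 4 * s * p := by positivity
  have hpi : 0 ≤ Real.pi / p := by positivity
  have h1 : (Real.pi / ((p / (1 + 4 * s * p) : ℝ) : ℂ) : ℂ) ^ (1 / 2 : ℂ) =
      (Real.pi / p : ℂ) ^ (1 / 2 : ℂ) * Complex.exp (Real.log (1 + 4 * s * p) / 2) := by
    have h2 : (Real.pi / ((p / (1 + 4 * s * p) : ℝ) : ℂ) : ℂ) =
        ((Real.pi / p : ℝ) : ℂ) * ((1 + 4 * s * p : ℝ) : ℂ) := by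
      push_cast
      rw [div_div_eq_mul_div]
      ring
    rw [h2, Complex.mul_cpow_ofReal_nonneg hpi hD.le,
      Complex.cpow_def_of_ne_zero (x := ((1 + 4 * s * p : ℝ) : ℂ)) (by exact_mod_cast hD.ne'),
      ← Complex.ofReal_log hD.le]
    push_cast
    ring_nf
  rw [h1, Complex.ofReal_exp, mul_left_comm,
    mul_assoc ((Real.pi / p : ℂ) ^ (1 / 2 : ℂ)), ← Complex.exp_add, ← Complex.exp_add]
  congr 2
  have hD' : (1 + 4 * s * p : ℂ) ≠ 0 := by exact_mod_cast hD.ne'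
  have hp' : (p : ℂ) ≠ 0 := by exact_mod_cast hp.ne'
  push_cast
  generalize hDs : (1 + 4 * s * p : ℂ) = D at hD' ⊢
  have hs' : (s : ℂ) = (D - 1) / (4 * p) := by
    rw [eq_div_iff (by simpa using hp'), ← hDs]
    ring
  rw [hs']
  field_simp
  linear_combination (8 * D * Real.pi ^ 2 * ξ ^ 2 * (1 - D) : ℂ) * Complex.I_sq

theorem heat_gaussianSchwartz (s : ℝ) (hs : 0 ≤ s) (p : ℝ) (hp : 0 < p) (b c : ℂ) :
    heat s hs ((gaussianSchwartz p hp b c).toLp 2) =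
      (gaussianSchwartz (p / (1 + 4 * s * p)) (by positivity) (b / (1 + 4 * s * p))
        (c + b ^ 2 * s / (1 + 4 * s * p) - Real.log (1 + 4 * s * p) / 2)).toLp 2 := by
  apply (Lp.fourierTransformₗᵢ ℝ ℂ).injective
  rw [fourier_heat, fourierTransformₗᵢ_toLp, fourierTransformₗᵢ_toLp]
  refine Lp.ext ?_
  filter_upwards [expNegSq_coeFn ((2 * Real.pi) ^ 2 * s) (by positivity)
      ((𝓕 (gaussianSchwartz p hp b c)).toLp 2),
    (𝓕 (gaussianSchwartz p hp b c)).coeFn_toLp 2 volume,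
    (𝓕 (gaussianSchwartz (p / (1 + 4 * s * p)) (by positivity) (b / (1 + 4 * s * p))
      (c + b ^ 2 * s / (1 + 4 * s * p) - Real.log (1 + 4 * s * p) / 2))).coeFn_toLp 2 volume]
    with x h1 h2 h3
  rw [h1, h2, h3, exp_mul_fourier_gaussianSchwartz s hs]

theorem mehler_gaussianSchwartz (t : ℝ≥0) (b c : ℂ) :
    mehler t ((gaussianSchwartz (1 / 2) (by norm_num) b c).toLp 2) =
      (gaussianSchwartz (1 / 2) (by norm_num) (b * Complex.exp (-2 * (t : ℝ)))
        (c - (t : ℝ) + b ^ 2 * (1 - Complex.exp (-4 * (t : ℝ))) / 4)).toLp 2 := by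
  have hE := Real.exp_pos (t : ℝ)
  have hE1 : 1 ≤ Real.exp (t : ℝ) := Real.one_le_exp t.coe_nonneg
  set E := Real.exp (t : ℝ) with hEdef
  have hsinh : Real.sinh (2 * t) = (E ^ 2 - (E ^ 2)⁻¹) / 2 := by
    rw [Real.sinh_eq, Real.exp_neg, hEdef, ← Real.exp_nat_mul]
    norm_num
  have htanh : Real.tanh t = (E ^ 2 - 1) / (E ^ 2 + 1) := by
    rw [Real.tanh_eq_sinh_div_cosh, Real.sinh_eq, Real.cosh_eq, Real.exp_neg, ← hEdef]
    field_simp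
  have hD : 1 + 4 * (Real.sinh (2 * t) / 2) * (1 / 2 + Real.tanh t / 2) = E ^ 2 := by
    rw [hsinh, htanh]
    field_simp
    ring
  have hDc : (1 + 4 * ((Real.sinh (2 * t) / 2 : ℝ) : ℂ) * ((1 / 2 + Real.tanh t / 2 : ℝ) : ℂ)) =
      (E : ℂ) ^ 2 := by exact_mod_cast hD
  have hEc : (E : ℂ) ≠ 0 := by exact_mod_cast hE.ne'
  have h2 : Complex.exp (-2 * (t : ℝ)) = ((E : ℂ) ^ 2)⁻¹ := by
    rw [hEdef, Complex.ofReal_exp, ← Complex.exp_nat_mul, ← Complex.exp_neg]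
    norm_num
  have h4 : Complex.exp (-4 * (t : ℝ)) = ((E : ℂ) ^ 4)⁻¹ := by
    rw [hEdef, Complex.ofReal_exp, ← Complex.exp_nat_mul, ← Complex.exp_neg]
    norm_num
  have hlog : Real.log (E ^ 2) = 2 * t := by
    rw [Real.log_pow, hEdef, Real.log_exp]
    norm_num
  rw [mehler_apply, expNegSq_gaussianSchwartz, heat_gaussianSchwartz, expNegSq_gaussianSchwartz]
  congr 1
  refine gaussianSchwartz_congr _ _ ?_ ?_ ?_
  · rw [hD, htanh]
    field_simp
    ring
  · rw [hDc, h2, div_eq_mul_inv]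
  · rw [hDc, hD, hlog, h4, hsinh]
    push_cast
    field_simp
    ring

theorem mehler_add (s t : ℝ≥0) : mehler (s + t) = (mehler s).comp (mehler t) := by
  ext1 u
  rw [← sub_eq_zero]
  refine eq_zero_of_inner_gaussian_eq_zero _ fun β => ?_
  rw [inner_sub_right, sub_eq_zero, ContinuousLinearMap.comp_apply, ← inner_mehler_left,
    ← inner_mehler_left, ← inner_mehler_left, mehler_gaussianSchwartz, mehler_gaussianSchwartz,
    mehler_gaussianSchwartz]
  congr 2
  refine gaussianSchwartz_congr _ _ rfl ?_ ?_
  · rw [mul_assoc _ (Complex.exp _), ← Complex.exp_add]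
    push_cast
    ring_nf
  · rw [mul_pow _ (Complex.exp _), ← Complex.exp_nat_mul]
    have h : Complex.exp (-4 * ((s + t : ℝ≥0) : ℝ)) =
        Complex.exp (-4 * (s : ℝ)) * Complex.exp (-4 * (t : ℝ)) := by
      rw [← Complex.exp_add]
      push_cast
      ring_nf
    have h' : Complex.exp ((2 : ℕ) * (-2 * ((s : ℝ) : ℂ))) = Complex.exp (-4 * (s : ℝ)) := by
      push_cast
      ring_nf
    rw [h, h']
    push_cast
    ring

/-! ### Strong continuity -/

theorem tendsto_contraction_apply {ι : Type*} {l : Filter ι} {A : ι → L2 →L[ℂ] L2} {v : ι → L2}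
    {v₀ w : L2} (hA : ∀ i u, ‖A i u‖ ≤ ‖u‖) (hv : Tendsto v l (𝓝 v₀))
    (hw : Tendsto (fun i => A i v₀) l (𝓝 w)) : Tendsto (fun i => A i (v i)) l (𝓝 w) := by
  have h1 : Tendsto (fun i => A i (v i - v₀)) l (𝓝 0) :=
    squeeze_zero_norm (fun i => hA i _) (tendsto_iff_norm_sub_tendsto_zero.1 hv)
  simpa using h1.add hw

theorem continuous_expNegSq_half_tanh (u : L2) :
    Continuous fun t : ℝ≥0 => expNegSq (Real.tanh t / 2) (half_tanh_nonneg t) u := by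
  have h : Continuous fun t : ℝ≥0 => (Real.tanh t / 2).toNNReal := by
    refine continuous_real_toNNReal.comp ?_
    simp_rw [Real.tanh_eq_sinh_div_cosh]
    have hc : ∀ t : ℝ≥0, Real.cosh t ≠ 0 := fun t => (Real.cosh_pos _).ne'
    fun_prop (disch := assumption)
  refine ((continuous_expNegSq_apply u).comp h).congr fun t => ?_
  rw [Function.comp_apply, expNegSq_congr (Real.coe_toNNReal _ (half_tanh_nonneg t)) _
    (half_tanh_nonneg t)]

theorem continuous_heat_half_sinh (u : L2) :
    Continuous fun t : ℝ≥0 => heat (Real.sinh (2 * t) / 2) (half_sinh_two_mul_nonneg t) u := by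
  have h : Continuous fun t : ℝ≥0 => (Real.sinh (2 * t) / 2).toNNReal :=
    continuous_real_toNNReal.comp (by fun_prop)
  refine ((continuous_heat_apply u).comp h).congr fun t => ?_
  rw [Function.comp_apply, heat_congr (Real.coe_toNNReal _ (half_sinh_two_mul_nonneg t)) _
    (half_sinh_two_mul_nonneg t)]

theorem continuous_mehler_apply (u : L2) : Continuous fun t : ℝ≥0 => mehler t u := by
  rw [continuous_iff_continuousAt]
  intro t
  have hM := fun s : ℝ≥0 => norm_expNegSq_apply_le _ (half_tanh_nonneg s)
  have hK := fun s : ℝ≥0 => norm_heat_apply_le _ (half_sinh_two_mul_nonneg s)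
  have h1 := tendsto_contraction_apply hK
    ((continuous_expNegSq_half_tanh u).tendsto t) ((continuous_heat_half_sinh _).tendsto t)
  have h2 := tendsto_contraction_apply hM h1 ((continuous_expNegSq_half_tanh _).tendsto t)
  simp only [ContinuousAt, mehler_apply]
  exact h2

/-- The semigroup formed by the operators `mehler t`. -/
def mehlerSemigroup : C0Semigroup where
  op := mehler
  op_zero := mehler_zero
  op_add := mehler_add
  continuous_orbit := continuous_mehler_apply

/-! ### The oscillator on Schwartz functions -/

/-- The function `-φ'' + x² φ`, for a Schwartz function `φ`. -/
def oscillatorSchwartz (φ : 𝓢(ℝ, ℂ)) : 𝓢(ℝ, ℂ) :=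
  -(SchwartzMap.derivCLM ℂ ℂ (SchwartzMap.derivCLM ℂ ℂ φ)) +
    SchwartzMap.smulLeftCLM ℂ (fun x : ℝ => (x : ℂ) ^ 2) φ

theorem smulLeftCLM_sq_apply (φ : 𝓢(ℝ, ℂ)) (x : ℝ) :
    SchwartzMap.smulLeftCLM ℂ (fun x : ℝ => (x : ℂ) ^ 2) φ x = (x : ℂ) ^ 2 * φ x :=
  SchwartzMap.smulLeftCLM_apply_apply (by fun_prop) φ x

theorem oscillatorSchwartz_apply (φ : 𝓢(ℝ, ℂ)) (x : ℝ) :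
    oscillatorSchwartz φ x = -deriv (deriv φ) x + (x : ℂ) ^ 2 * φ x := by
  have hd : ⇑(SchwartzMap.derivCLM ℂ ℂ φ) = deriv φ := by
    ext y
    simp
  rw [oscillatorSchwartz, add_apply, smulLeftCLM_sq_apply, neg_apply,
    SchwartzMap.derivCLM_apply, hd]

theorem tendsto_inv_smul_comp {N : ℝ≥0 → L2} {g : L2} {α : ℝ≥0 → ℝ≥0} {f : ℝ → ℝ} {κ : ℝ}
    (hN : Tendsto (fun a : ℝ≥0 => ((a : ℝ) : ℂ)⁻¹ • N a) (𝓝[>] 0) (𝓝 g))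
    (hα : ∀ h, (α h : ℝ) = f h) (hf0 : f 0 = 0) (hf : HasDerivAt f κ 0)
    (hpos : ∀ h, 0 < h → 0 < α h) :
    Tendsto (fun h : ℝ≥0 => ((h : ℝ) : ℂ)⁻¹ • N (α h)) (𝓝[>] 0) (𝓝 ((κ : ℂ) • g)) := by
  have h1 : Tendsto α (𝓝[>] 0) (𝓝[>] 0) := by
    refine tendsto_nhdsWithin_iff.2 ⟨?_, ?_⟩
    · rw [← NNReal.tendsto_coe]
      simp_rw [hα]
      have : Tendsto (fun h : ℝ≥0 => (h : ℝ)) (𝓝[>] 0) (𝓝 0) :=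
        (NNReal.continuous_coe.tendsto' 0 0 rfl).mono_left nhdsWithin_le_nhds
      simpa [hf0] using! hf.continuousAt.tendsto.comp this
    · filter_upwards [self_mem_nhdsWithin] with h hh
      exact hpos h hh
  refine ((tendsto_inv_mul_sub_of_hasDerivAt hf).smul (hN.comp h1)).congr' ?_
  filter_upwards [self_mem_nhdsWithin] with h hh
  have : ((α h : ℝ) : ℂ) ≠ 0 := by exact_mod_cast (hpos h hh).ne'
  rw [Function.comp_apply, smul_smul, hf0, sub_zero, ← hα]
  push_cast
  rw [mul_assoc, mul_inv_cancel₀ this, mul_one]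

theorem hasDerivAt_tanh_div_two : HasDerivAt (fun t : ℝ => Real.tanh t / 2) (1 / 2) 0 := by
  have h := ((Real.hasDerivAt_sinh 0).div (Real.hasDerivAt_cosh 0) (Real.cosh_pos 0).ne').div_const 2
  simp only [Real.cosh_zero, Real.sinh_zero] at h
  norm_num at h
  refine h.congr_of_eventuallyEq (Eventually.of_forall fun t => ?_)
  simp [Real.tanh_eq_sinh_div_cosh]

theorem tendsto_expNegSq_half_tanh_sub_div (φ : 𝓢(ℝ, ℂ)) :
    Tendsto (fun h : ℝ≥0 => ((h : ℝ) : ℂ)⁻¹ •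
        (expNegSq (Real.tanh h / 2) (half_tanh_nonneg h) (φ.toLp 2) - φ.toLp 2 volume)) (𝓝[>] 0)
      (𝓝 (-((1 / 2 : ℂ) •
        (SchwartzMap.smulLeftCLM ℂ (fun x : ℝ => (x : ℂ) ^ 2) φ).toLp 2 volume))) := by
  have h1 := tendsto_expNegSq_sub_div (φ.toLp 2)
    ((SchwartzMap.smulLeftCLM ℂ (fun x : ℝ => (x : ℂ) ^ 2) φ).toLp 2) (by
      filter_upwards [φ.coeFn_toLp 2 volume,
        (SchwartzMap.smulLeftCLM ℂ (fun x : ℝ => (x : ℂ) ^ 2) φ).coeFn_toLp 2 volume]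
        with x h1 h2
      rw [h1, h2, smulLeftCLM_sq_apply])
  have h2 := tendsto_inv_smul_comp (α := fun t : ℝ≥0 => ⟨Real.tanh t / 2, half_tanh_nonneg t⟩)
    h1 (fun _ => rfl) (by simp) hasDerivAt_tanh_div_two (fun h hh => by
      change 0 < Real.tanh h / 2
      rw [Real.tanh_eq_sinh_div_cosh]
      have := Real.sinh_pos_iff.2 (NNReal.coe_pos.2 hh)
      have := Real.cosh_pos (h : ℝ)
      positivity)
  rw [smul_neg] at h2
  push_cast at h2
  exact h2

theorem tendsto_heat_half_sinh_sub_div (φ : 𝓢(ℝ, ℂ)) :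
    Tendsto (fun h : ℝ≥0 => ((h : ℝ) : ℂ)⁻¹ •
        (heat (Real.sinh (2 * h) / 2) (half_sinh_two_mul_nonneg h) (φ.toLp 2) - φ.toLp 2 volume))
      (𝓝[>] 0)
      (𝓝 ((SchwartzMap.derivCLM ℂ ℂ (SchwartzMap.derivCLM ℂ ℂ φ)).toLp 2 volume)) := by
  have hd : HasDerivAt (fun t : ℝ => Real.sinh (2 * t) / 2) 1 0 := by
    have := (((hasDerivAt_id (0 : ℝ)).const_mul 2).sinh).div_const 2
    simpa using this
  have h2 := tendsto_inv_smul_comp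
    (α := fun t : ℝ≥0 => ⟨Real.sinh (2 * t) / 2, half_sinh_two_mul_nonneg t⟩)
    (tendsto_heat_sub_div φ) (fun _ => rfl) (by simp) hd (fun h hh => by
      change 0 < Real.sinh (2 * h) / 2
      have h0 : 0 < (h : ℝ) := hh
      have := Real.sinh_pos_iff.2 (mul_pos two_pos h0)
      positivity)
  rw [Complex.ofReal_one, one_smul] at h2
  exact h2

/-- Schwartz functions are in the domain of the generator of `mehlerSemigroup`. -/
theorem tendsto_mehler_sub_div (φ : 𝓢(ℝ, ℂ)) :
    Tendsto (fun h : ℝ≥0 => ((h : ℝ) : ℂ)⁻¹ • (mehler h (φ.toLp 2) - φ.toLp 2 volume)) (𝓝[>] 0)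
      (𝓝 (-(oscillatorSchwartz φ).toLp 2 volume)) := by
  have hl : (𝓝[>] (0 : ℝ≥0)) ≤ 𝓝 0 := nhdsWithin_le_nhds
  have hM : ∀ u : L2, Tendsto (fun h : ℝ≥0 => expNegSq (Real.tanh h / 2) (half_tanh_nonneg h) u)
      (𝓝[>] 0) (𝓝 u) := fun u => by
    refine ((continuous_expNegSq_half_tanh u).tendsto' 0 u ?_).mono_left hl
    rw [expNegSq_congr (by simp) (half_tanh_nonneg 0) le_rfl, expNegSq_zero]
    rfl
  have hK : ∀ u : L2, Tendsto
      (fun h : ℝ≥0 => heat (Real.sinh (2 * h) / 2) (half_sinh_two_mul_nonneg h) u)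
      (𝓝[>] 0) (𝓝 u) := fun u => by
    refine ((continuous_heat_half_sinh u).tendsto' 0 u ?_).mono_left hl
    rw [heat_congr (by simp) (half_sinh_two_mul_nonneg 0) le_rfl, heat_zero]
    rfl
  have hMc := fun h : ℝ≥0 => norm_expNegSq_apply_le _ (half_tanh_nonneg h)
  have hKc := fun h : ℝ≥0 => norm_heat_apply_le _ (half_sinh_two_mul_nonneg h)
  have h1 := tendsto_expNegSq_half_tanh_sub_div φ
  have h2 := tendsto_heat_half_sinh_sub_div φ
  have h3 := ((tendsto_contraction_apply hMc (tendsto_contraction_apply hKc h1 (hK _)) (hM _)).add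
    (tendsto_contraction_apply hMc h2 (hM _))).add h1
  refine (h3.congr fun h => ?_).trans (le_of_eq ?_)
  · rw [mehler_apply]
    simp only [map_smul, map_sub, ← smul_add]
    congr 1
    abel
  · congr 1
    simp only [oscillatorSchwartz, ← SchwartzMap.toLpCLM_apply (𝕜 := ℂ), map_add, map_neg]
    module

/-! ### The graph of the oscillator in terms of the inner product -/

/-- The complex conjugate of a Schwartz function. -/
def conjSchwartz (φ : 𝓢(ℝ, ℂ)) : 𝓢(ℝ, ℂ) :=
  SchwartzMap.postcompCLM (𝕜 := ℝ) (Complex.conjCLE : ℂ →L[ℝ] ℂ) φ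

theorem conjSchwartz_apply (φ : 𝓢(ℝ, ℂ)) (x : ℝ) :
    conjSchwartz φ x = starRingEnd ℂ (φ x) := by
  simp [conjSchwartz]

theorem conjSchwartz_conjSchwartz (φ : 𝓢(ℝ, ℂ)) : conjSchwartz (conjSchwartz φ) = φ := by
  ext x
  rw [conjSchwartz_apply, conjSchwartz_apply, Complex.conj_conj]

theorem derivCLM_conjSchwartz (φ : 𝓢(ℝ, ℂ)) :
    SchwartzMap.derivCLM ℂ ℂ (conjSchwartz φ) = conjSchwartz (SchwartzMap.derivCLM ℂ ℂ φ) := by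
  ext x
  rw [conjSchwartz_apply, SchwartzMap.derivCLM_apply, SchwartzMap.derivCLM_apply]
  have h : ⇑(conjSchwartz φ) = fun x => (Complex.conjCLE : ℂ →L[ℝ] ℂ) (φ x) := by
    ext x
    simp [conjSchwartz]
  rw [h]
  exact ((Complex.conjCLE : ℂ →L[ℝ] ℂ).hasFDerivAt.comp_hasDerivAt x (φ.hasDerivAt x)).deriv

theorem oscillatorSchwartz_conjSchwartz (φ : 𝓢(ℝ, ℂ)) :
    oscillatorSchwartz (conjSchwartz φ) = conjSchwartz (oscillatorSchwartz φ) := by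
  ext x
  simp only [oscillatorSchwartz, derivCLM_conjSchwartz, add_apply, neg_apply,
    conjSchwartz_apply, smulLeftCLM_sq_apply, map_add, map_neg, map_mul, map_pow,
    Complex.conj_ofReal]

theorem toTemperedDistribution_apply_eq_inner (u : L2) (φ : 𝓢(ℝ, ℂ)) :
    Lp.toTemperedDistributionCLM ℂ volume 2 u φ = inner ℂ ((conjSchwartz φ).toLp 2) u := by
  rw [inner_toLp_left, Lp.toTemperedDistributionCLM_apply, Lp.toTemperedDistribution_apply]
  simp_rw [conjSchwartz_apply, Complex.conj_conj, smul_eq_mul]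

theorem mem_oscillatorGraph_iff (u f : L2) :
    (u, f) ∈ oscillatorGraph ↔ ∀ φ : 𝓢(ℝ, ℂ),
      inner ℂ ((oscillatorSchwartz φ).toLp 2) u = inner ℂ (φ.toLp 2) f := by
  have h : (u, f) ∈ oscillatorGraph ↔
      oscillatorDistrib (Lp.toTemperedDistributionCLM ℂ volume 2 u) =
        Lp.toTemperedDistributionCLM ℂ volume 2 f := Iff.rfl
  rw [h, DFunLike.ext_iff]
  simp_rw [oscillatorDistrib_apply _ _ _ (oscillatorSchwartz_apply _),
    toTemperedDistribution_apply_eq_inner, ← oscillatorSchwartz_conjSchwartz]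
  refine ⟨fun H φ => ?_, fun H φ => H _⟩
  have := H (conjSchwartz φ)
  rwa [conjSchwartz_conjSchwartz] at this

/-! ### Right derivatives of functions on `ℝ≥0` -/

theorem C0Semigroup.mem_generatorGraph_iff (S : C0Semigroup) (u f : L2) :
    (u, f) ∈ S.generatorGraph ↔
      Tendsto (fun h : ℝ≥0 => ((h : ℝ) : ℂ)⁻¹ • (S.op h u - u)) (𝓝[>] 0) (𝓝 f) := Iff.rfl

theorem hasDerivWithinAt_comp_toNNReal {E : Type*} [NormedAddCommGroup E] [NormedSpace ℝ E]
    {G : ℝ≥0 → E} {s : ℝ≥0} {e : E}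
    (h : Tendsto (fun h : ℝ≥0 => (h : ℝ)⁻¹ • (G (s + h) - G s)) (𝓝[>] 0) (𝓝 e)) :
    HasDerivWithinAt (fun y : ℝ => G y.toNNReal) e (Set.Ioi (s : ℝ)) s := by
  rw [hasDerivWithinAt_iff_tendsto_slope' (by simp)]
  have h1 : Tendsto (fun y : ℝ => (y - s).toNNReal) (𝓝[>] (s : ℝ)) (𝓝[>] 0) := by
    refine tendsto_nhdsWithin_iff.2 ⟨?_, ?_⟩
    · have : Continuous fun y : ℝ => (y - s).toNNReal :=
        continuous_real_toNNReal.comp (by fun_prop)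
      exact (this.tendsto' (s : ℝ) 0 (by simp)).mono_left nhdsWithin_le_nhds
    · filter_upwards [self_mem_nhdsWithin] with y hy
      exact Real.toNNReal_pos.2 (sub_pos.2 hy)
  refine (h.comp h1).congr' ?_
  filter_upwards [self_mem_nhdsWithin] with y hy
  have hy' : (s : ℝ) ≤ y := le_of_lt hy
  have h2 : s + (y - s).toNNReal = y.toNNReal := by
    rw [← NNReal.coe_inj, NNReal.coe_add, Real.coe_toNNReal _ (sub_nonneg.2 hy'),
      Real.coe_toNNReal _ (s.coe_nonneg.trans hy')]
    ring
  rw [Function.comp_apply, h2, slope_def_module, Real.coe_toNNReal _ (sub_nonneg.2 hy'),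
    Real.toNNReal_coe]

theorem coe_inv_smul_eq (h : ℝ≥0) (u : L2) : ((h : ℝ) : ℂ)⁻¹ • u = (h : ℝ)⁻¹ • u := by
  rw [← Complex.ofReal_inv]
  exact algebraMap_smul ℂ ((h : ℝ)⁻¹) u

/-! ### The generator of the factorized evolution -/

theorem mem_oscillatorGraph_of_mem_generatorGraph {u f : L2}
    (h : (u, f) ∈ mehlerSemigroup.generatorGraph) : (u, -f) ∈ oscillatorGraph := by
  rw [C0Semigroup.mem_generatorGraph_iff] at h
  rw [mem_oscillatorGraph_iff]
  intro φ
  have h1 : Tendsto (fun t : ℝ≥0 => inner ℂ (φ.toLp 2 volume)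
      (((t : ℝ) : ℂ)⁻¹ • (mehler t u - u))) (𝓝[>] 0) (𝓝 (inner ℂ (φ.toLp 2 volume) f)) :=
    tendsto_const_nhds.inner h
  have h2 := (tendsto_mehler_sub_div φ).inner (𝕜 := ℂ) (tendsto_const_nhds (x := u))
  have h3 := tendsto_nhds_unique (h1.congr fun h => ?_) h2
  · rw [inner_neg_right, h3, inner_neg_left, neg_neg]
  · rw [inner_smul_right, inner_smul_left, inner_sub_left, inner_sub_right, inner_mehler_left,
      map_inv₀, Complex.conj_ofReal]

theorem continuous_mehler_toNNReal (u : L2) : Continuous fun s : ℝ => mehler s.toNNReal u :=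
  (continuous_mehler_apply u).comp continuous_real_toNNReal

theorem hasDerivWithinAt_inner_mehler_gaussian {u f : L2} (h : (u, -f) ∈ oscillatorGraph)
    (b c : ℂ) (s : ℝ≥0) :
    HasDerivWithinAt (fun y : ℝ => inner ℂ
        (mehler y.toNNReal ((gaussianSchwartz (1 / 2) (by norm_num) b c).toLp 2)) u)
      (inner ℂ ((gaussianSchwartz (1 / 2) (by norm_num) b c).toLp 2) (mehler s f))
      (Set.Ioi (s : ℝ)) s := by
  rw [← inner_mehler_left]
  refine hasDerivWithinAt_comp_toNNReal (G := fun y : ℝ≥0 => (inner ℂ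
    (mehler y ((gaussianSchwartz (1 / 2) (by norm_num) b c).toLp 2 volume)) u : ℂ)) (s := s) ?_
  simp_rw [add_comm s, mehler_add, ContinuousLinearMap.comp_apply, mehler_gaussianSchwartz s]
  set φ := gaussianSchwartz (1 / 2) (by norm_num) (b * Complex.exp (-2 * (s : ℝ)))
    (c - (s : ℝ) + b ^ 2 * (1 - Complex.exp (-4 * (s : ℝ))) / 4)
  have h1 := (tendsto_mehler_sub_div φ).inner (𝕜 := ℂ) (tendsto_const_nhds (x := u))
  rw [inner_neg_left, (mem_oscillatorGraph_iff _ _).1 h φ, inner_neg_right, neg_neg] at h1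
  refine h1.congr fun y => ?_
  rw [inner_smul_left, inner_sub_left, map_inv₀, Complex.conj_ofReal, Complex.real_smul,
    Complex.ofReal_inv]

theorem mehler_sub_eq_integral {u f : L2} (h : (u, -f) ∈ oscillatorGraph) (t : ℝ≥0) :
    mehler t u - u = ∫ s in (0 : ℝ)..t, mehler s.toNNReal f := by
  rw [← sub_eq_zero]
  refine eq_zero_of_inner_gaussian_eq_zero _ fun β => ?_
  set g : L2 := (gaussianSchwartz (1 / 2) (by norm_num) (Complex.I * β) 0).toLp 2 volume with hg
  have hcont : Continuous fun s : ℝ => inner ℂ g (mehler s.toNNReal f) :=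
    continuous_const.inner (continuous_mehler_toNNReal f)
  have h1 : ∫ s in (0 : ℝ)..t, inner ℂ g (mehler s.toNNReal f) =
      inner ℂ (mehler (t : ℝ).toNNReal g) u - inner ℂ (mehler (0 : ℝ).toNNReal g) u := by
    refine intervalIntegral.integral_eq_sub_of_hasDeriv_right_of_le
      (f := fun y : ℝ => inner ℂ (mehler y.toNNReal g) u) t.coe_nonneg
      ((continuous_mehler_toNNReal g).inner continuous_const).continuousOn (fun x hx => ?_)
      (hcont.intervalIntegrable _ _)
    have := hasDerivWithinAt_inner_mehler_gaussian h (Complex.I * β) 0 x.toNNReal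
    rwa [Real.coe_toNNReal x hx.1.le] at this
  have h2 : ∫ s in (0 : ℝ)..t, inner ℂ g (mehler s.toNNReal f) =
      inner ℂ g (∫ s in (0 : ℝ)..t, mehler s.toNNReal f) :=
    (innerSL ℂ g).intervalIntegral_comp_comm
      ((continuous_mehler_toNNReal f).intervalIntegrable _ _)
  rw [h2, Real.toNNReal_coe, Real.toNNReal_zero, inner_mehler_left, mehler_zero] at h1
  rw [inner_sub_right, h1, inner_sub_right]
  exact sub_self _

theorem mem_generatorGraph_of_mem_oscillatorGraph {u f : L2} (h : (u, -f) ∈ oscillatorGraph) :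
    (u, f) ∈ mehlerSemigroup.generatorGraph := by
  rw [C0Semigroup.mem_generatorGraph_iff]
  have h1 : HasDerivAt (fun t : ℝ => ∫ s in (0 : ℝ)..t, mehler s.toNNReal f) f 0 := by
    have := (continuous_mehler_toNNReal f).integral_hasStrictDerivAt 0 0
    rw [Real.toNNReal_zero, mehler_zero] at this
    exact this.hasDerivAt
  have h2 : Tendsto (fun a : ℝ≥0 => (a : ℝ)) (𝓝[>] 0) (𝓝[≠] 0) := by
    refine tendsto_nhdsWithin_iff.2 ⟨?_, ?_⟩
    · exact (NNReal.continuous_coe.tendsto' 0 0 rfl).mono_left nhdsWithin_le_nhds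
    · filter_upwards [self_mem_nhdsWithin] with a ha
      exact (NNReal.coe_pos.2 ha).ne'
  refine ((hasDerivAt_iff_tendsto_slope.1 h1).comp h2).congr fun a => ?_
  rw [Function.comp_apply, slope_def_module, intervalIntegral.integral_same, sub_zero, sub_zero,
    ← mehler_sub_eq_integral h, coe_inv_smul_eq]
  rfl

theorem generator_mehlerSemigroup : mehlerSemigroup.generator = -harmonicOscillator := by
  refine LinearPMap.eq_of_eq_graph ?_
  rw [C0Semigroup.generator_graph, LinearPMap.neg_graph, harmonicOscillator_graph]
  ext ⟨u, f⟩
  rw [Submodule.mem_map]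
  constructor
  · intro h
    exact ⟨(u, -f), mem_oscillatorGraph_of_mem_generatorGraph h, by simp⟩
  · rintro ⟨⟨v, g⟩, hv, he⟩
    obtain ⟨rfl, rfl⟩ : v = u ∧ -g = f := by simpa using he
    exact mem_generatorGraph_of_mem_oscillatorGraph (by rwa [neg_neg])

/-! ### Uniqueness of the semigroup with a given generator -/

theorem C0Semigroup.op_mem_generatorGraph (S : C0Semigroup) {u f : L2}
    (h : (u, f) ∈ S.generatorGraph) (s : ℝ≥0) : (S.op s u, S.op s f) ∈ S.generatorGraph := by
  rw [mem_generatorGraph_iff] at h ⊢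
  refine (((S.op s).continuous.tendsto _).comp h).congr fun t => ?_
  rw [Function.comp_apply, map_smul, map_sub, ← ContinuousLinearMap.comp_apply,
    ← ContinuousLinearMap.comp_apply, ← S.op_add, ← S.op_add, add_comm]

theorem C0Semigroup.hasDerivWithinAt_comp (S T : C0Semigroup) (hT : ∀ t u, ‖T.op t u‖ ≤ ‖u‖)
    {u f : L2} (hS' : (u, f) ∈ S.generatorGraph)
    (hgen : S.generatorGraph = T.generatorGraph) (t s : ℝ≥0) (hst : s < t) :
    HasDerivWithinAt (fun y : ℝ => T.op (t - y.toNNReal) (S.op y.toNNReal u)) 0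
      (Set.Ioi (s : ℝ)) s := by
  refine hasDerivWithinAt_comp_toNNReal (G := fun y => T.op (t - y) (S.op y u)) ?_
  have h1 := S.op_mem_generatorGraph hS' s
  have h2 := h1
  rw [hgen] at h2
  rw [mem_generatorGraph_iff] at h1 h2
  have h3 := h1.sub h2
  rw [sub_self] at h3
  refine (tendsto_contraction_apply (A := fun h => T.op (t - (s + h))) (fun h => hT _) h3
    (by simp)).congr' ?_
  have hlt : ∀ᶠ h : ℝ≥0 in 𝓝[>] 0, h < t - s :=
    nhdsWithin_le_nhds (Iio_mem_nhds (tsub_pos_of_lt hst))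
  filter_upwards [hlt] with h hh
  have e1 : t - s = (t - (s + h)) + h := by
    rw [← tsub_tsub, tsub_add_cancel_of_le hh.le]
  rw [e1, T.op_add, add_comm s h, S.op_add, ← smul_sub, map_smul, coe_inv_smul_eq,
    ContinuousLinearMap.comp_apply, ContinuousLinearMap.comp_apply, sub_sub_sub_cancel_right,
    map_sub]

theorem C0Semigroup.op_eq_of_generatorGraph_eq (S T : C0Semigroup)
    (hT : ∀ t u, ‖T.op t u‖ ≤ ‖u‖) (hgen : S.generatorGraph = T.generatorGraph)
    (hdense : Dense {u : L2 | ∃ f, (u, f) ∈ S.generatorGraph}) (t : ℝ≥0) :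
    S.op t = T.op t := by
  have key : Set.EqOn (S.op t) (T.op t) {u : L2 | ∃ f, (u, f) ∈ S.generatorGraph} := by
    rintro u ⟨f, hu⟩
    have hcont : Continuous fun y : ℝ≥0 => T.op (t - y) (S.op y u) := by
      rw [continuous_iff_continuousAt]
      intro y
      have h1 : Continuous fun z : ℝ≥0 => T.op (t - z) (S.op y u) :=
        (T.continuous_orbit _).comp (by fun_prop)
      exact tendsto_contraction_apply (A := fun z => T.op (t - z)) (fun z => hT _)
        ((S.continuous_orbit u).tendsto y) (h1.tendsto y)
    have h2 := constant_of_has_deriv_right_zero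
      (f := fun y : ℝ => T.op (t - y.toNNReal) (S.op y.toNNReal u)) (a := 0) (b := t)
      (hcont.comp continuous_real_toNNReal).continuousOn (fun x hx => by
        have hx' : x.toNNReal < t := by
          rw [← NNReal.coe_lt_coe, Real.coe_toNNReal x hx.1]
          exact hx.2
        have h3 := S.hasDerivWithinAt_comp T hT hu hgen t x.toNNReal hx'
        rw [Real.coe_toNNReal x hx.1] at h3
        exact hasDerivWithinAt_Ioi_iff_Ici.1 h3) t ⟨t.coe_nonneg, le_rfl⟩
    simp only [Real.toNNReal_coe, tsub_self, T.op_zero, Real.toNNReal_zero, tsub_zero,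
      S.op_zero] at h2
    exact h2
  exact DFunLike.coe_injective
    (Continuous.ext_on hdense (S.op t).continuous (T.op t).continuous key)

theorem dense_domain_mehlerSemigroup :
    Dense {u : L2 | ∃ f, (u, f) ∈ mehlerSemigroup.generatorGraph} := by
  refine (SchwartzMap.denseRange_toLpCLM (E := ℝ) (F := ℂ) (μ := volume) (p := 2)
    ENNReal.ofNat_ne_top).mono ?_
  rintro _ ⟨φ, rfl⟩
  exact ⟨_, tendsto_mehler_sub_div φ⟩

end HarmonicSplitting

end

theorem mainTheorem6 :
    (∃ S : HarmonicSplitting.C0Semigroup,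
      S.generator = -HarmonicSplitting.harmonicOscillator) ∧
    ∀ S : HarmonicSplitting.C0Semigroup,
      S.generator = -HarmonicSplitting.harmonicOscillator →
      ∀ t : ℝ≥0,
        S.op t =
          (HarmonicSplitting.expNegSq (Real.tanh t / 2)
              (HarmonicSplitting.half_tanh_nonneg t)).comp
            ((HarmonicSplitting.heat (Real.sinh (2 * t) / 2)
                (HarmonicSplitting.half_sinh_two_mul_nonneg t)).comp
              (HarmonicSplitting.expNegSq (Real.tanh t / 2)
                (HarmonicSplitting.half_tanh_nonneg t))) ∧
        Function.Injective (S.op t) := by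
  refine ⟨⟨_, HarmonicSplitting.generator_mehlerSemigroup⟩, fun S hS t => ?_⟩
  have hgen : S.generatorGraph = HarmonicSplitting.mehlerSemigroup.generatorGraph := by
    rw [← HarmonicSplitting.C0Semigroup.generator_graph,
      ← HarmonicSplitting.C0Semigroup.generator_graph, hS,
      HarmonicSplitting.generator_mehlerSemigroup]
  have hop : S.op t = HarmonicSplitting.mehler t :=
    S.op_eq_of_generatorGraph_eq HarmonicSplitting.mehlerSemigroup
      HarmonicSplitting.norm_mehler_apply_le hgen
      (by rw [hgen]; exact HarmonicSplitting.dense_domain_mehlerSemigroup) t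
  rw [hop]
  exact ⟨rfl, HarmonicSplitting.mehler_injective t⟩
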